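/- **Theorem (Validity).** Let $f\ge 0$ and $n=2f+1$, and consider the following DAG-based protocol run by $n$ replicas numbered $0,\dots,n-1$, at most $f$ of which crash; a replica that never crashes is called correct. *Blocks and dissemination.* Each replica proposes one block in each of the rounds $1,2,3,\dots$ and sends it to all replicas. A block carries its author, its round, a list of transactions, and references to earlier blocks. A replica adds a block to its local DAG only once all blocks referenced by it are there; when it receives a block, it requests the referenced blocks that are missing in its DAG from the sender, and a replica replies to a request with the requested block if it has it in its DAG. A block of round $1$ has no references. For $R\ge1$, a replica may propose its block of round $R+1$ only when its local DAG contains its own block and at least $f+1$ blocks of round $R$ (it may then wait for an arbitrary finite time, e.g. for further blocks or for a timeout); this block references the first $f+1$ blocks of round $R$ that were added to the local DAG, its author's block of round $R$, and any further blocks of rounds $\le R$ from the local DAG. *Decision rule.* Fix $1\le\ell\le n$. The skeleton slots are the pairs $(R,i)$, $R\ge1$, $0\le i<\ell$, ordered lexicographically; slot $(R,i)$ belongs to replica $(R+i)\bmod n$ and contains that replica's block of round $R$, if any. Given a local DAG, its slots up to its highest round are classified from the last to the first. A slot $(R,i)$ that contains a block $b$ is committed if at least $f+1$ blocks of round $R+1$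 reference $b$. Otherwise, consider the first slot of a round $>R+1$ that is not skipped (the anchor): if it is committed, then $(R,i)$ is committed if it contains a block and there is a path of references from the anchor's block to this block, and skipped if not; if there is no anchor or the anchor is undecided, $(R,i)$ is undecided. The replica goes through the slots in order up to the first undecided one, and for each committed slot it commits all blocks of the causal history of the slot's block (including that block) that it has not committed before, in some fixed deterministic order. *Random asynchronous model.* Every message between correct replicas is eventually delivered, and correct replicas eventually carry out every step they can take; there is no bound on delays, and messages from or to crashing replicas may be lost. The first $f+1$ blocks of a round that a replica receives form a random sample: there are independent, uniformly random orders $\pi_{p,R}$ of the $n$ replicas, one for each replica $p$ and round $R$, such that for every correct $p$ and every $R$, among the first $f+1$ blocks of round $R$ added to the local DAG of $p$, each has an author that precedes in $\pi_{p,R}$ every correct replica that is not an author of one of these blocks. (If no replica crashes, their authors are thus exactly the first $f+1$ replicas of $\pi_{p,R}$, a uniformly random $(f+1)$-subset.) The scheduling is otherwise arbitrary. Then, with probability $1$, for every block $B$ proposed by a correct replica and every correct replica $q$, from some time on $B$ belongs to the sequence of blocks committed by $q$. -/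

import Mathlib

namespace NemoNemo

noncomputable section

open scoped Classical

/-! ## Replicas, blocks, messages -/

/-- The `n = 2f + 1` replicas. -/
abbrev Replica (f : ℕ) : Type := Fin (2 * f + 1)

/-- A reference to a block: its author and its round. A replica proposes at most one block in
each round, so that such a pair designates at most one block. -/
abbrev Ref (f : ℕ) : Type := Replica f × ℕ

/-- A block: author, round number (rounds are numbered from `1`), list of transactions, and
references to blocks of earlier rounds. -/
structure Block (f : ℕ) (Tx : Type*) where
  author : Replica f
  round : ℕ
  txs : List Tx
  refs : Finset (Ref f)

/-- The reference that designates the block `b`. -/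
def Block.ref {f : ℕ} {Tx : Type*} (b : Block f Tx) : Ref f := (b.author, b.round)

/-- Content of a message: a block (disseminated by its author, or sent in reply to a request), or
a request for a missing block. -/
inductive Message (f : ℕ) (Tx : Type*) where
  | block (b : Block f Tx)
  | request (r : Ref f)

/-- A message together with its sender and its receiver. -/
structure Packet (f : ℕ) (Tx : Type*) where
  src : Replica f
  dst : Replica f
  msg : Message f Tx

/-! ## The decision rule and the commit sequence, as functions of a local DAG

A local DAG is the list of its blocks, in the order in which the replica added them. -/

section Consensus

variable {f : ℕ} {Tx : Type*}

/-- The blocks of round `r` in the local DAG, in the order in which they were added. -/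
def blocksAt (D : List (Block f Tx)) (r : ℕ) : List (Block f Tx) :=
  D.filter (fun b => b.round = r)

/-- The first `f + 1` blocks of round `r` that were added to the local DAG. -/
def firstBlocks (D : List (Block f Tx)) (r : ℕ) : List (Block f Tx) :=
  (blocksAt D r).take (f + 1)

/-- `b` is a block of the DAG that references `b'`. -/
def IsParent (D : List (Block f Tx)) (b b' : Block f Tx) : Prop :=
  b ∈ D ∧ b'.ref ∈ b.refs

/-- There is a (possibly trivial) path of references in the DAG from `new` to `old`; that is,
`old` is in the causal history of `new`. -/
def IsLink (D : List (Block f Tx)) (new old : Block f Tx) : Prop :=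
  Relation.ReflTransGen (IsParent D) new old

/-- The replica that owns the skeleton slot of round `r` and rank `l` (round robin). -/
def leader (f r l : ℕ) : Replica f := Fin.ofNat (2 * f + 1) (r + l)

/-- The block in the skeleton slot of round `r` and rank `l`, if the DAG has one. -/
def leaderBlock (D : List (Block f Tx)) (r l : ℕ) : Option (Block f Tx) :=
  D.find? (fun b => b.round = r ∧ b.author = leader f r l)

/-- At least `f + 1` blocks of the round after that of `b` vote for `b`. The wave of a block of
round `r` consists of the rounds `r` (propose) and `r + 1` (decide). -/
def Supported (D : List (Block f Tx)) (b : Block f Tx) : Prop :=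
  f + 1 ≤ (D.toFinset.filter (fun b' => b'.round = b.round + 1 ∧ IsLink D b' b)).card

/-- State of a skeleton slot. -/
inductive Status (f : ℕ) (Tx : Type*) where
  | commit (b : Block f Tx)
  | skip
  | undecided

/-- A skeleton slot (round and rank) with its state. -/
structure Decision (f : ℕ) (Tx : Type*) where
  round : ℕ
  rank : ℕ
  status : Status f Tx

/-- Direct decision rule for the slot of round `r` and rank `l`. -/
def tryDirectDecide (D : List (Block f Tx)) (r l : ℕ) : Status f Tx :=
  match leaderBlock D r l with
  | some b => if Supported D b then .commit b else .undecided
  | none => .undecided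

/-- Indirect decision rule for the slot of round `r` and rank `l`; `S` is the list of the states
of the later slots, in the order of the slots. The anchor is the first slot of a round `> r + 1`
that is not skipped. -/
def tryIndirectDecide (D : List (Block f Tx)) (r l : ℕ) (S : List (Decision f Tx)) :
    Status f Tx :=
  match S.find? (fun s => r + 1 < s.round ∧ s.status ≠ .skip) with
  | some ⟨_, _, .commit anchor⟩ =>
      match leaderBlock D r l with
      | some b => if IsLink D anchor b then .commit b else .skip
      | none => .skip
  | _ => .undecided

/-- The direct rule and, if it leaves the slot undecided, the indirect rule. -/
def decideSlot (D : List (Block f Tx)) (r l : ℕ) (S : List (Decision f Tx)) : Status f Tx :=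
  match tryDirectDecide D r l with
  | .undecided => tryIndirectDecide D r l S
  | s => s

/-- The skeleton slots (round, rank) of the rounds `1, …, h`, in increasing order. -/
def slots (leadersPerRound h : ℕ) : List (ℕ × ℕ) :=
  (List.range h).flatMap fun i => (List.range leadersPerRound).map fun l => (i + 1, l)

/-- The highest round of a block in the DAG. -/
def highestRound (D : List (Block f Tx)) : ℕ := (D.map Block.round).foldr max 0

/-- The states of all skeleton slots up to the highest round of the DAG, computed from the last
slot down to the first one. -/
def tryDecide (leadersPerRound : ℕ) (D : List (Block f Tx)) : List (Decision f Tx) :=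
  (slots leadersPerRound (highestRound D)).foldr
    (fun s S => ⟨s.1, s.2, decideSlot D s.1 s.2 S⟩ :: S) []

/-- The committed skeleton blocks that precede the first undecided slot. -/
def committedLeaders (leadersPerRound : ℕ) (D : List (Block f Tx)) : List (Block f Tx) :=
  ((tryDecide leadersPerRound D).takeWhile (fun s => s.status ≠ .undecided)).filterMap
    fun s => match s.status with
      | .commit b => some b
      | _ => none

/-- Given the output `O` so far, append for each skeleton block in the list its causal history
without the blocks that have been output already, in the deterministic order `order`. -/
def linearizeSubDags (order : Finset (Block f Tx) → List (Block f Tx)) (D : List (Block f Tx)) :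
    List (Block f Tx) → List (Block f Tx) → List (Block f Tx)
  | O, [] => O
  | O, b :: L =>
      linearizeSubDags order D
        (O ++ order (D.toFinset.filter (fun b' => IsLink D b b' ∧ b' ∉ O))) L

/-- The sequence of the blocks that a replica with local DAG `D` has committed. -/
def commitSequence (leadersPerRound : ℕ) (order : Finset (Block f Tx) → List (Block f Tx))
    (D : List (Block f Tx)) : List (Block f Tx) :=
  linearizeSubDags order D [] (committedLeaders leadersPerRound D)

end Consensus

/-! ## The protocol as a transition system -/

/-- Local state of a replica. -/
structure LocalState (f : ℕ) (Tx : Type*) where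
  /-- the last round in which the replica has proposed a block (`0` before its first block) -/
  round : ℕ
  /-- the blocks that the replica has proposed -/
  proposed : Set (Block f Tx)
  /-- the blocks that the replica has received or created -/
  store : Set (Block f Tx)
  /-- the local DAG, in the order of insertion -/
  dag : List (Block f Tx)
  /-- whether the replica has crashed -/
  crashed : Prop

/-- Global state: the local states, and all messages sent so far. -/
structure GlobalState (f : ℕ) (Tx : Type*) where
  loc : Replica f → LocalState f Tx
  sent : Set (Packet f Tx)

/-- Initially, nothing has been proposed, received or sent, and nobody has crashed. -/
def initialState (f : ℕ) (Tx : Type*) : GlobalState f Tx where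
  loc := fun _ => ⟨0, ∅, ∅, [], False⟩
  sent := ∅

/-- The events of an execution. Which event comes next is up to the scheduler. -/
inductive Event (f : ℕ) (Tx : Type*) where
  /-- `p` proposes its next block, with transactions `txs` and with additional references to the
  blocks of its local DAG that are listed in `extra` -/
  | propose (p : Replica f) (txs : List Tx) (extra : Finset (Ref f))
  /-- a message is delivered -/
  | deliver (m : Packet f Tx)
  /-- `p` adds the block `b` to its local DAG -/
  | add (p : Replica f) (b : Block f Tx)
  /-- `p` crashes -/
  | crash (p : Replica f)

section Protocol

variable {f : ℕ} {Tx : Type*}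

/-- A replica can propose its next block when it is about to propose its first block, or when its
local DAG contains its own block and at least `f + 1` blocks of the last round in which it
proposed. (It may then wait longer, for the skeleton blocks of that round or for a timeout; how
long it waits is up to the scheduler.) -/
def Ready (p : Replica f) (st : LocalState f Tx) : Prop :=
  st.round = 0 ∨
    (f + 1 ≤ (blocksAt st.dag st.round).length ∧
      ∃ b ∈ st.dag, b.author = p ∧ b.round = st.round)

/-- The next block of `p`: it references the first `f + 1` blocks of the previous round in the
local DAG of `p`, the previous block of `p`, and any additional blocks of earlier rounds in the
local DAG of `p`. -/
def newBlock (p : Replica f) (st : LocalState f Tx) (txs : List Tx) (extra : Finset (Ref f)) :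
    Block f Tx where
  author := p
  round := st.round + 1
  txs := txs
  refs :=
    ((firstBlocks st.dag st.round).map Block.ref).toFinset ∪
    ((st.dag.filter (fun b => b.author = p ∧ b.round = st.round)).map Block.ref).toFinset ∪
    ((st.dag.filter (fun b => b.round ≤ st.round ∧ b.ref ∈ extra)).map Block.ref).toFinset

/-- The local DAG contains a block that is designated by the reference `r`. -/
def HasRef (D : List (Block f Tx)) (r : Ref f) : Prop := ∃ b ∈ D, b.ref = r

/-- The replica has received `b`, has not added it to its local DAG yet, and can add it, because
its local DAG contains all blocks that `b` references (hence the causal history of `b`). -/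
def CanAdd (st : LocalState f Tx) (b : Block f Tx) : Prop :=
  b ∈ st.store ∧ b ∉ st.dag ∧ ∀ r ∈ b.refs, HasRef st.dag r

/-- One step of an execution. An event that is not possible has no effect.
* Proposing a block sends it to all replicas.
* A replica that receives a block requests from the sender every block referenced there
  that it does not have in its local DAG.
* A replica that receives a request replies with the requested block, if it has that block in its
  local DAG.
* A crashed replica takes no steps. -/
def step (s : GlobalState f Tx) : Event f Tx → GlobalState f Tx
  | .propose p txs extra =>
      let st := s.loc p
      let b := newBlock p st txs extra
      if ¬ st.crashed ∧ Ready p st then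
        { loc := Function.update s.loc p
            { st with
              round := st.round + 1
              proposed := insert b st.proposed
              store := insert b st.store }
          sent := s.sent ∪ {m | ∃ q, m = ⟨p, q, .block b⟩} }
      else s
  | .deliver m =>
      let st := s.loc m.dst
      if m ∈ s.sent ∧ ¬ st.crashed then
        match m.msg with
        | .block b =>
            { loc := Function.update s.loc m.dst { st with store := insert b st.store }
              sent := s.sent ∪
                {m' | ∃ r ∈ b.refs, ¬ HasRef st.dag r ∧ m' = ⟨m.dst, m.src, .request r⟩} }
        | .request r =>
            { s with
              sent := s.sent ∪
                {m' | ∃ b ∈ st.dag, b.ref = r ∧ m' = ⟨m.dst, m.src, .block b⟩} }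
      else s
  | .add p b =>
      let st := s.loc p
      if ¬ st.crashed ∧ CanAdd st b then
        { s with loc := Function.update s.loc p { st with dag := st.dag ++ [b] } }
      else s
  | .crash p =>
      { s with loc := Function.update s.loc p { s.loc p with crashed := True } }

/-- The state after the first `t` events of the schedule `e`. -/
def run (e : ℕ → Event f Tx) : ℕ → GlobalState f Tx
  | 0 => initialState f Tx
  | t + 1 => step (run e t) (e t)

/-- A replica is correct in an execution if it never crashes. -/
def Correct (e : ℕ → Event f Tx) (p : Replica f) : Prop :=
  ∀ t, ¬ ((run e t).loc p).crashed

/-- The asynchronous executions with at most `f` crashes: messages between correct replicas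
eventually arrive, and correct replicas eventually carry out the steps that they can take. No
bound is assumed on any delay, and nothing is assumed on messages from or to replicas that
crash. -/
structure IsExecution (e : ℕ → Event f Tx) : Prop where
  /-- at most `f` replicas crash -/
  faults : {p : Replica f | ¬ Correct e p}.ncard ≤ f
  /-- reliable links between correct replicas: a message that is sent is delivered at least once
  after it has been sent -/
  links : ∀ t, ∀ m ∈ (run e t).sent, Correct e m.src → Correct e m.dst →
    ∃ t', m ∈ (run e t').sent ∧ e t' = .deliver m
  /-- a correct replica eventually adds a block whose causal history it has downloaded -/
  adds : ∀ t p b, Correct e p → CanAdd ((run e t).loc p) b → ∃ t' ≥ t, e t' = .add p b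
  /-- a correct replica that can propose its next block eventually does so -/
  proposes : ∀ t p, Correct e p → Ready p ((run e t).loc p) →
    ∃ t' ≥ t, ∃ txs extra, e t' = .propose p txs extra

end Protocol

/-! ## Random asynchrony -/

section Random

open MeasureTheory ProbabilityTheory

variable {f : ℕ} {Tx : Type*}

/-- A family of independent, uniformly distributed random orders of the replicas, one for each
replica `p` and round `r`; `π (p, r) ω q` is the position of `q` in the order for `(p, r)`. -/
structure IsRandomOrders {Ω : Type*} [MeasurableSpace Ω] (μ : Measure Ω)
    (π : Replica f × ℕ → Ω → Equiv.Perm (Replica f)) : Prop where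
  measurable : ∀ i σ, MeasurableSet {ω | π i ω = σ}
  uniform : ∀ i σ, μ {ω | π i ω = σ} = ((Nat.factorial (2 * f + 1) : ℕ) : ENNReal)⁻¹
  indep : iIndepFun (m := fun _ => ⊤) π μ

/-- The first `f + 1` blocks of a round `r` that a correct replica `p` receives (with their causal
history, that is, adds to its local DAG) are those that come first in the order `ρ (p, r)` among
the blocks that compete. The replicas that do not crash compete in every round; a block of a
replica that crashes at some time may be lost or delayed arbitrarily. If nobody crashes, the
authors of the first `f + 1` blocks are exactly the first `f + 1` replicas in the order
`ρ (p, r)`. -/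
def FollowsOrders (ρ : Replica f × ℕ → Equiv.Perm (Replica f)) (e : ℕ → Event f Tx) : Prop :=
  ∀ p r t, Correct e p →
    f + 1 ≤ (blocksAt ((run e t).loc p).dag r).length →
    ∀ q, Correct e q → (∀ b ∈ firstBlocks ((run e t).loc p).dag r, b.author ≠ q) →
      ∀ b ∈ firstBlocks ((run e t).loc p).dag r, ρ (p, r) b.author < ρ (p, r) q

/-- The random asynchronous model: for a random schedule `e` of events, almost surely `e` is an
execution with at most `f` crashes in which, for each correct replica and each round, the first
`f + 1` blocks received form a uniform random sample (independent for different replicas and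
rounds). Apart from that, the schedule is arbitrary, and may depend on the randomness. -/
structure RandomAsynchronous {Ω : Type*} [MeasurableSpace Ω] (μ : Measure Ω)
    (π : Replica f × ℕ → Ω → Equiv.Perm (Replica f)) (e : Ω → ℕ → Event f Tx) : Prop where
  orders : IsRandomOrders μ π
  execution : ∀ᵐ ω ∂μ, IsExecution (e ω)
  follows : ∀ᵐ ω ∂μ, FollowsOrders (fun i => π i ω) (e ω)

end Random

end

end NemoNemo

/-!
Validity of the commit rule holds because one favourable group of three successive rounds
`s, s + 1, s + 2` is enough to commit a given block `B` of a correct replica `p`, and because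
favourable groups recur almost surely.

Progress. The sender of a block always has the blocks that are referenced there
(`wellFormed_run`), so a correct receiver obtains the causal history from the same sender, by
induction on the round (`exists_mem_dag_of_sent`). Hence all correct replicas, of which there are
at least `f + 1`, propose in every round (`exists_le_round`), and each of them eventually has all
their blocks.

Favourable rounds. By pigeonhole two replicas `c` and `c + 1` that are neighbours in the
round-robin order are correct. Let `c` own the first slot of round `s + 1`, so that `c + 1` owns
that of round `s + 2`, and suppose that `p`, `c`, `c + 1` come first in all random orders of the
rounds `s`, `s + 1`, `s + 2`, respectively. Then the block of `c` of round `s + 1` references the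
block of `p` of round `s`, whose history contains `B`, as each block references the previous block
of its author. All correct blocks of rounds `s + 2` and `s + 3` vote for the first slots of rounds
`s + 1` and `s + 2`, so both slots are directly committed. Two committed first slots in successive
rounds settle everything before them: descending through the slots of rounds `≤ s`, the anchor is
always a committed slot (`exists_decideFrom_decided`). So the block of `c` is reached by the
replica, and its history, with `B`, is committed (`eventually_mem_commitSequence`). This holds for
every sufficiently large local DAG, so stability of decisions as the DAG grows is not an issue.

Recurrence. For fixed `c` and `p`, the events above for rounds `s` spaced by `3 * (2 * f + 1)` are
independent and of the same positive probability, so infinitely many of them occur almost surely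
by the second Borel-Cantelli lemma (`IsRandomOrders.ae_frequently`). Both `c` and the set of
correct replicas may depend on the randomness; since there are finitely many pairs `(c, p)`, the
statement can be made for all of them at once before `c` is chosen.
-/

namespace NemoNemo

open scoped Classical

section Transitions

variable {f : ℕ} {Tx : Type*}

/-! ### The effect of one step -/

theorem step_dag (s : GlobalState f Tx) (ev : Event f Tx) (p : Replica f) :
    ((step s ev).loc p).dag = (s.loc p).dag ∨
      ∃ b, CanAdd (s.loc p) b ∧ ((step s ev).loc p).dag = (s.loc p).dag ++ [b] := by
  rcases ev with ⟨q, txs, extra⟩ | ⟨src, q, b | r⟩ | ⟨q, b⟩ | q <;> simp only [step] <;>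
    (try split_ifs with h) <;> by_cases hp : p = q <;>
    (try subst hp) <;> simp_all

theorem step_proposed (s : GlobalState f Tx) (ev : Event f Tx) (p : Replica f) :
    (((step s ev).loc p).proposed = (s.loc p).proposed ∧
        ((step s ev).loc p).round = (s.loc p).round) ∨
      ∃ txs extra, Ready p (s.loc p) ∧
        ((step s ev).loc p).proposed =
          insert (newBlock p (s.loc p) txs extra) (s.loc p).proposed ∧
        ((step s ev).loc p).round = (s.loc p).round + 1 ∧
        ∀ q, ⟨p, q, .block (newBlock p (s.loc p) txs extra)⟩ ∈ (step s ev).sent := by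
  rcases ev with ⟨q, txs, extra⟩ | ⟨src, q, b | r⟩ | ⟨q, b⟩ | q
  · simp only [step]
    split_ifs with h
    · by_cases hp : p = q
      · subst hp
        exact Or.inr ⟨txs, extra, h.2, by simp, by simp, fun q => by simp⟩
      · exact Or.inl (by simp [hp])
    · simp
  all_goals
    refine Or.inl ?_
    simp only [step]
    (try split_ifs with h) <;> by_cases hp : p = q <;> (try subst hp) <;> simp_all

theorem step_store (s : GlobalState f Tx) (ev : Event f Tx) (p : Replica f) :
    (s.loc p).store ⊆ ((step s ev).loc p).store ∧
      ∀ b ∈ ((step s ev).loc p).store, b ∈ (s.loc p).store ∨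
        b.author = p ∧ b ∈ ((step s ev).loc p).proposed ∨ ∃ src, ⟨src, p, .block b⟩ ∈ s.sent := by
  rcases ev with ⟨q, txs, extra⟩ | ⟨src, q, b | r⟩ | ⟨q, b⟩ | q
  · simp only [step]
    split_ifs with h
    · by_cases hp : p = q
      · subst hp
        refine ⟨by simp, fun b hb => ?_⟩
        rcases (by simpa using hb : b = _ ∨ b ∈ _) with rfl | hb
        · exact Or.inr (Or.inl ⟨rfl, by simp⟩)
        · exact Or.inl hb
      · exact ⟨by simp [hp], fun b hb => Or.inl (by simpa [hp] using hb)⟩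
    · exact ⟨subset_rfl, fun b hb => Or.inl hb⟩
  · simp only [step]
    split_ifs with h
    · by_cases hp : p = q
      · subst hp
        refine ⟨by simp, fun b' hb => ?_⟩
        rcases (by simpa using hb : b' = _ ∨ b' ∈ _) with rfl | hb
        · exact Or.inr (Or.inr ⟨src, h.1⟩)
        · exact Or.inl hb
      · exact ⟨by simp [hp], fun b hb => Or.inl (by simpa [hp] using hb)⟩
    · exact ⟨subset_rfl, fun b hb => Or.inl hb⟩
  all_goals
    simp only [step]
    (try split_ifs with h) <;> by_cases hp : p = q <;> (try subst hp) <;> simp_all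

theorem step_sent (s : GlobalState f Tx) (ev : Event f Tx) :
    s.sent ⊆ (step s ev).sent ∧ ∀ m ∈ (step s ev).sent, m ∈ s.sent ∨
      (∃ b, m.msg = .block b ∧ b.author = m.src ∧ b ∈ ((step s ev).loc m.src).proposed) ∨
      (∃ b r, m.msg = .request r ∧ ⟨m.dst, m.src, .block b⟩ ∈ s.sent ∧ r ∈ b.refs) ∨
      ∃ b, m.msg = .block b ∧ b ∈ (s.loc m.src).dag := by
  rcases ev with ⟨q, txs, extra⟩ | ⟨src, q, b | r⟩ | ⟨q, b⟩ | q
  · simp only [step]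
    split_ifs with h
    · refine ⟨Set.subset_union_left, ?_⟩
      rintro m (hm | ⟨q', rfl⟩)
      · exact Or.inl hm
      · exact Or.inr (Or.inl ⟨_, rfl, rfl, by simp⟩)
    · exact ⟨subset_rfl, fun b hb => Or.inl hb⟩
  · simp only [step]
    split_ifs with h
    · refine ⟨Set.subset_union_left, ?_⟩
      rintro m (hm | ⟨r, hr, -, rfl⟩)
      · exact Or.inl hm
      · exact Or.inr (Or.inr (Or.inl ⟨b, r, rfl, h.1, hr⟩))
    · exact ⟨subset_rfl, fun b hb => Or.inl hb⟩
  · simp only [step]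
    split_ifs with h
    · refine ⟨Set.subset_union_left, ?_⟩
      rintro m (hm | ⟨b, hb, -, rfl⟩)
      · exact Or.inl hm
      · exact Or.inr (Or.inr (Or.inr ⟨b, rfl, hb⟩))
    · exact ⟨subset_rfl, fun b hb => Or.inl hb⟩
  all_goals
    simp only [step]
    (try split_ifs with h) <;> exact ⟨subset_rfl, fun b hb => Or.inl hb⟩

/-! ### Monotonicity along an execution -/

variable {e : ℕ → Event f Tx}

theorem mem_dag_mono {t t' : ℕ} (h : t ≤ t') {p : Replica f} {b : Block f Tx}
    (hb : b ∈ ((run e t).loc p).dag) : b ∈ ((run e t').loc p).dag := by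
  induction t', h using Nat.le_induction with
  | base => exact hb
  | succ n _ ih =>
    rcases step_dag (run e n) (e n) p with h | ⟨b', -, h⟩ <;> simp [run, h, ih]

theorem HasRef.mono {t t' : ℕ} (h : t ≤ t') {p : Replica f} {r : Ref f}
    (hr : HasRef ((run e t).loc p).dag r) : HasRef ((run e t').loc p).dag r :=
  let ⟨b, hb, hbr⟩ := hr
  ⟨b, mem_dag_mono h hb, hbr⟩

theorem mem_store_mono {t t' : ℕ} (h : t ≤ t') {p : Replica f} {b : Block f Tx}
    (hb : b ∈ ((run e t).loc p).store) : b ∈ ((run e t').loc p).store := by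
  induction t', h using Nat.le_induction with
  | base => exact hb
  | succ n _ ih => exact (step_store (run e n) (e n) p).1 ih

theorem mem_sent_mono {t t' : ℕ} (h : t ≤ t') {m : Packet f Tx}
    (hm : m ∈ (run e t).sent) : m ∈ (run e t').sent := by
  induction t', h using Nat.le_induction with
  | base => exact hm
  | succ n _ ih => exact (step_sent (run e n) (e n)).1 ih

theorem mem_proposed_mono {t t' : ℕ} (h : t ≤ t') {p : Replica f} {b : Block f Tx}
    (hb : b ∈ ((run e t).loc p).proposed) : b ∈ ((run e t').loc p).proposed := by
  induction t', h using Nat.le_induction with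
  | base => exact hb
  | succ n _ ih =>
    rcases step_proposed (run e n) (e n) p with h | ⟨_, _, -, h, -⟩
    · simpa [run, h.1] using ih
    · simp [run, h, ih]

theorem round_mono {t t' : ℕ} (h : t ≤ t') (p : Replica f) :
    ((run e t).loc p).round ≤ ((run e t').loc p).round := by
  induction t', h using Nat.le_induction with
  | base => exact le_rfl
  | succ n _ ih =>
    rcases step_proposed (run e n) (e n) p with h | ⟨_, _, -, -, h, -⟩ <;> simp only [run] <;> omega

/-! ### Invariants of an execution -/

/-- A proposed block was built by `newBlock` at a moment when its author was ready. -/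
theorem exists_newBlock_of_mem_proposed {t : ℕ} {p : Replica f} {b : Block f Tx}
    (hb : b ∈ ((run e t).loc p).proposed) :
    ∃ t' < t, ∃ txs extra, Ready p ((run e t').loc p) ∧
      b = newBlock p ((run e t').loc p) txs extra ∧
      ((run e t').loc p).round < ((run e t).loc p).round ∧
      ∀ q, ⟨p, q, .block b⟩ ∈ (run e t).sent := by
  induction t with
  | zero => simp [run, initialState] at hb
  | succ n ih =>
    have old : b ∈ ((run e n).loc p).proposed → ∃ t' < n + 1, ∃ txs extra,
        Ready p ((run e t').loc p) ∧ b = newBlock p ((run e t').loc p) txs extra ∧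
        ((run e t').loc p).round < ((run e (n + 1)).loc p).round ∧
        ∀ q, ⟨p, q, .block b⟩ ∈ (run e (n + 1)).sent := fun hb => by
      obtain ⟨t', ht', txs, extra, h1, h2, h3, h4⟩ := ih hb
      exact ⟨t', ht'.trans n.lt_succ_self, txs, extra, h1, h2,
        h3.trans_le (round_mono n.le_succ p), fun q => mem_sent_mono n.le_succ (h4 q)⟩
    rcases step_proposed (run e n) (e n) p with h | ⟨txs, extra, hr, h, hrd, hs⟩
    · exact old (by simpa [run, h.1] using hb)
    · rw [run, h] at hb
      rcases hb with rfl | hb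
      · exact ⟨n, n.lt_succ_self, txs, extra, hr, rfl, by simp [run, hrd], hs⟩
      · exact old hb

theorem author_of_mem_proposed {t : ℕ} {p : Replica f} {b : Block f Tx}
    (hb : b ∈ ((run e t).loc p).proposed) : b.author = p := by
  obtain ⟨_, _, _, _, -, rfl, -⟩ := exists_newBlock_of_mem_proposed hb
  rfl

theorem one_le_round_of_mem_proposed {t : ℕ} {p : Replica f} {b : Block f Tx}
    (hb : b ∈ ((run e t).loc p).proposed) : 1 ≤ b.round := by
  obtain ⟨_, _, _, _, -, rfl, -⟩ := exists_newBlock_of_mem_proposed hb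
  exact Nat.le_add_left _ _

theorem round_le_of_mem_proposed {t : ℕ} {p : Replica f} {b : Block f Tx}
    (hb : b ∈ ((run e t).loc p).proposed) : b.round ≤ ((run e t).loc p).round := by
  obtain ⟨_, _, _, _, -, rfl, h, -⟩ := exists_newBlock_of_mem_proposed hb
  exact h

/-- A replica proposes at most one block per round. -/
theorem eq_of_mem_proposed {t : ℕ} {p : Replica f} {b b' : Block f Tx}
    (hb : b ∈ ((run e t).loc p).proposed) (hb' : b' ∈ ((run e t).loc p).proposed)
    (h : b.round = b'.round) : b = b' := by
  induction t with
  | zero => simp [run, initialState] at hb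
  | succ n ih =>
    rcases step_proposed (run e n) (e n) p with hs | ⟨txs, extra, hr, hs, -, -⟩
    · rw [run, hs.1] at hb hb'
      exact ih hb hb'
    · rw [run, hs] at hb hb'
      rcases hb with rfl | hb <;> rcases hb' with rfl | hb'
      · rfl
      · have := round_le_of_mem_proposed hb'
        simp only [newBlock] at h
        omega
      · have := round_le_of_mem_proposed hb
        simp only [newBlock] at h
        omega
      · exact ih hb hb'

theorem exists_mem_proposed {t : ℕ} {p : Replica f} {k : ℕ} (hk : 1 ≤ k)
    (hkt : k ≤ ((run e t).loc p).round) : ∃ b ∈ ((run e t).loc p).proposed, b.round = k := by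
  induction t with
  | zero =>
    simp only [run, initialState] at hkt
    omega
  | succ n ih =>
    have old (h : k ≤ ((run e n).loc p).round) :
        ∃ b ∈ ((run e (n + 1)).loc p).proposed, b.round = k :=
      let ⟨b, hb, hbk⟩ := ih h
      ⟨b, mem_proposed_mono n.le_succ hb, hbk⟩
    rcases step_proposed (run e n) (e n) p with hs | ⟨txs, extra, -, hs, hrd, -⟩
    · exact old (by simpa [run, hs.2] using hkt)
    · rcases Nat.lt_or_ge ((run e n).loc p).round k with h | h
      · refine ⟨newBlock p ((run e n).loc p) txs extra, by simp [run, hs], ?_⟩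
        simp only [run, hrd] at hkt
        simp only [newBlock]
        omega
      · exact old h

theorem hasRef_of_mem_newBlock_refs {p : Replica f} {st : LocalState f Tx} {txs : List Tx}
    {extra : Finset (Ref f)} {r : Ref f} (hr : r ∈ (newBlock p st txs extra).refs) :
    HasRef st.dag r ∧ r.2 ≤ st.round := by
  simp only [newBlock, Finset.mem_union, List.mem_toFinset, List.mem_map, firstBlocks] at hr
  rcases hr with (⟨b, hb, rfl⟩ | ⟨b, hb, rfl⟩) | ⟨b, hb, rfl⟩
  · have := List.mem_of_mem_take hb
    simp only [blocksAt, List.mem_filter, decide_eq_true_eq] at this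
    exact ⟨⟨b, this.1, rfl⟩, this.2.le⟩
  · simp only [List.mem_filter, decide_eq_true_eq] at hb
    exact ⟨⟨b, hb.1, rfl⟩, hb.2.2.le⟩
  · simp only [List.mem_filter, decide_eq_true_eq] at hb
    exact ⟨⟨b, hb.1, rfl⟩, hb.2.1⟩

/-- The references of a block point to earlier rounds, and its author has the referenced blocks. -/
theorem hasRef_of_mem_proposed {t : ℕ} {p : Replica f} {b : Block f Tx}
    (hb : b ∈ ((run e t).loc p).proposed) {r : Ref f} (hr : r ∈ b.refs) :
    HasRef ((run e t).loc p).dag r ∧ r.2 < b.round := by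
  obtain ⟨t', ht', txs, extra, -, rfl, -⟩ := exists_newBlock_of_mem_proposed hb
  have := hasRef_of_mem_newBlock_refs hr
  exact ⟨this.1.mono ht'.le, Nat.lt_succ_of_le this.2⟩

/-- A block references the previous block of its author. -/
theorem own_ref_mem_refs {t : ℕ} {p : Replica f} {b : Block f Tx}
    (hb : b ∈ ((run e t).loc p).proposed) {k : ℕ} (hk : 1 ≤ k) (hbk : b.round = k + 1) :
    (p, k) ∈ b.refs := by
  obtain ⟨t', -, txs, extra, hr, rfl, -⟩ := exists_newBlock_of_mem_proposed hb
  obtain rfl : ((run e t').loc p).round = k := Nat.succ_injective hbk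
  rcases hr with hr | ⟨-, b, hb, hbp, hbr⟩
  · omega
  · simp only [newBlock, Finset.mem_union, List.mem_toFinset, List.mem_map, List.mem_filter,
      decide_eq_true_eq]
    exact Or.inl (Or.inr ⟨b, ⟨hb, hbp, hbr⟩, by simp [Block.ref, hbp, hbr]⟩)

/-- All blocks in circulation have been proposed by their authors; the sender of a block has the
blocks referenced there, so that a request reaches a replica that can answer it. -/
structure WellFormed (s : GlobalState f Tx) : Prop where
  store : ∀ p, ∀ b ∈ (s.loc p).store, b ∈ (s.loc b.author).proposed
  dag : ∀ p, ∀ b ∈ (s.loc p).dag,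
    b ∈ (s.loc b.author).proposed ∧ ∀ r ∈ b.refs, HasRef (s.loc p).dag r
  block : ∀ src dst b, ⟨src, dst, .block b⟩ ∈ s.sent →
    b ∈ (s.loc b.author).proposed ∧ ∀ r ∈ b.refs, HasRef (s.loc src).dag r
  request : ∀ src dst r, ⟨src, dst, .request r⟩ ∈ s.sent → HasRef (s.loc dst).dag r

theorem wellFormed_run (e : ℕ → Event f Tx) (t : ℕ) : WellFormed (run e t) := by
  induction t with
  | zero => constructor <;> simp [run, initialState]
  | succ n ih =>
    have hmono {b : Block f Tx} {p} : b ∈ ((run e n).loc p).proposed →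
      b ∈ ((run e (n + 1)).loc p).proposed := mem_proposed_mono n.le_succ
    have rmono {r : Ref f} {p} : HasRef ((run e n).loc p).dag r →
      HasRef ((run e (n + 1)).loc p).dag r := HasRef.mono n.le_succ
    constructor
    · intro p b hb
      rcases (step_store (run e n) (e n) p).2 b hb with h | ⟨rfl, h⟩ | ⟨src, h⟩
      · exact hmono (ih.store p b h)
      · exact h
      · exact hmono (ih.block _ _ b h).1
    · intro p b hb
      have old (h : b ∈ ((run e n).loc p).dag) :
          b ∈ ((run e (n + 1)).loc b.author).proposed ∧
            ∀ r ∈ b.refs, HasRef ((run e (n + 1)).loc p).dag r :=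
        ⟨hmono (ih.dag p b h).1, fun r hr => rmono ((ih.dag p b h).2 r hr)⟩
      rcases step_dag (run e n) (e n) p with h | ⟨b', hc, h⟩
      · exact old (by simpa [run, h] using hb)
      · rw [run, h, List.mem_append, List.mem_singleton] at hb
        rcases hb with hb | rfl
        · exact old hb
        · exact ⟨hmono (ih.store p b hc.1), fun r hr => rmono (hc.2.2 r hr)⟩
    · intro src dst b hm
      rcases (step_sent (run e n) (e n)).2 _ hm with
        h | ⟨b', hb, rfl, h⟩ | ⟨b', r, hb, -⟩ | ⟨b', hb, h⟩
      · exact ⟨hmono (ih.block _ _ b h).1, fun r hr => rmono ((ih.block _ _ b h).2 r hr)⟩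
      · cases hb
        exact ⟨h, fun r hr => (hasRef_of_mem_proposed (e := e) (t := n + 1) h hr).1⟩
      · cases hb
      · cases hb
        exact ⟨hmono (ih.dag _ b h).1, fun r hr => rmono ((ih.dag _ b h).2 r hr)⟩
    · intro src dst r hm
      rcases (step_sent (run e n) (e n)).2 _ hm with
        h | ⟨b', hb, -⟩ | ⟨b', r', hb, h, hr⟩ | ⟨b', hb, -⟩
      · exact rmono (ih.request _ _ r h)
      · cases hb
      · cases hb
        exact rmono ((ih.block _ _ b' h).2 r hr)
      · cases hb

/-- Two blocks of one local DAG that are designated by the same reference are equal. -/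
theorem eq_of_ref_eq {t : ℕ} {p : Replica f} {b b' : Block f Tx}
    (hb : b ∈ ((run e t).loc p).dag) (hb' : b' ∈ ((run e t).loc p).dag)
    (h : b.ref = b'.ref) : b = b' := by
  have h1 := ((wellFormed_run e t).dag p b hb).1
  have h2 := ((wellFormed_run e t).dag p b' hb').1
  simp only [Block.ref, Prod.mk.injEq] at h
  rw [← h.1] at h2
  exact eq_of_mem_proposed h1 h2 h.2

/-! ### Delivery and progress -/

/-- A block sent by a correct replica to a correct replica is eventually added to the local DAG
of the receiver: the receiver obtains the blocks referenced there from the same sender, and these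
blocks are of earlier rounds. -/
theorem exists_mem_dag_of_sent (he : IsExecution e) {p q : Replica f} (hp : Correct e p)
    (hq : Correct e q) {b : Block f Tx} {t : ℕ} (hb : ⟨p, q, .block b⟩ ∈ (run e t).sent) :
    ∃ t', b ∈ ((run e t').loc q).dag := by
  induction hk : b.round using Nat.strong_induction_on generalizing b t with
  | _ k ih =>
  obtain ⟨t₁, hm, hd⟩ := he.links t _ hb hp hq
  have hstep : run e (t₁ + 1) = step (run e t₁) (.deliver ⟨p, q, .block b⟩) := by rw [run, hd]
  have hstore : b ∈ ((run e (t₁ + 1)).loc q).store := by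
    rw [hstep]
    simp [step, hm, hq t₁]
  have hrefs : ∀ r ∈ b.refs, ∀ᶠ t in Filter.atTop, HasRef ((run e t).loc q).dag r := by
    intro r hr
    suffices ∃ t, HasRef ((run e t).loc q).dag r by
      obtain ⟨t, ht⟩ := this
      filter_upwards [Filter.eventually_ge_atTop t] with t' h using ht.mono h
    by_cases hq' : HasRef ((run e t₁).loc q).dag r
    · exact ⟨t₁, hq'⟩
    have hreq : ⟨q, p, .request r⟩ ∈ (run e (t₁ + 1)).sent := by
      rw [hstep]
      simp only [step, hm, hq t₁, not_false_eq_true, and_self, if_true]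
      exact Or.inr ⟨r, hr, hq', rfl⟩
    -- The request may be delivered before `t₁`, in case it had been sent earlier; the sender can
    -- answer it at any time.
    obtain ⟨t₂, hm₂, hd₂⟩ := he.links _ _ hreq hq hp
    obtain ⟨b', hb', hbr⟩ := (wellFormed_run e t₂).request _ _ _ hm₂
    have hrep : ⟨p, q, .block b'⟩ ∈ (run e (t₂ + 1)).sent := by
      rw [run, hd₂]
      simp only [step, hm₂, hp t₂, not_false_eq_true, and_self, if_true]
      exact Or.inr ⟨b', hb', hbr, rfl⟩
    have hlt : b'.round < k := by
      have := (hasRef_of_mem_proposed ((wellFormed_run e t₁).block _ _ _ hm).1 hr).2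
      rw [← hbr, hk] at this
      exact this
    obtain ⟨t₃, ht₃⟩ := ih _ hlt hrep rfl
    exact ⟨t₃, b', ht₃, hbr⟩
  obtain ⟨T, hT, hT'⟩ := (((Filter.eventually_all_finset b.refs).2 hrefs).and
    (Filter.eventually_ge_atTop (t₁ + 1))).exists
  by_cases hdag : b ∈ ((run e T).loc q).dag
  · exact ⟨T, hdag⟩
  obtain ⟨t₄, ht₄, ha⟩ := he.adds T q b hq ⟨mem_store_mono hT' hstore, hdag, hT⟩
  by_cases hdag' : b ∈ ((run e t₄).loc q).dag
  · exact ⟨t₄, hdag'⟩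
  refine ⟨t₄ + 1, ?_⟩
  have hc : CanAdd ((run e t₄).loc q) b :=
    ⟨mem_store_mono (hT'.trans ht₄) hstore, hdag', fun r hr => (hT r hr).mono ht₄⟩
  rw [run, ha]
  simp [step, hq t₄, hc]

theorem eventually_mem_dag (he : IsExecution e) {p q : Replica f} (hp : Correct e p)
    (hq : Correct e q) {b : Block f Tx} {t : ℕ} (hb : b ∈ ((run e t).loc p).proposed) :
    ∀ᶠ t in Filter.atTop, b ∈ ((run e t).loc q).dag := by
  obtain ⟨_, _, _, _, -, -, -, hs⟩ := exists_newBlock_of_mem_proposed hb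
  obtain ⟨t', ht'⟩ := exists_mem_dag_of_sent he hp hq (hs q)
  filter_upwards [Filter.eventually_ge_atTop t'] with T hT using mem_dag_mono hT ht'

theorem card_correct (he : IsExecution e) :
    f + 1 ≤ (Finset.univ.filter (Correct e)).card := by
  have h1 := he.faults
  have h2 := Finset.card_filter_add_card_filter_not (s := Finset.univ) (Correct e)
  rw [Set.ncard_eq_toFinset_card', Set.toFinset_ofPred] at h1
  simp only [Finset.card_univ, Fintype.card_fin] at h2
  omega

theorem succ_le_card_of_forall_correct (he : IsExecution e) {s : Finset (Block f Tx)}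
    (h : ∀ p, Correct e p → ∃ b ∈ s, b.author = p) : f + 1 ≤ s.card := by
  refine (card_correct he).trans ?_
  refine (Finset.card_le_card (t := s.image Block.author) fun p hp => ?_).trans
    Finset.card_image_le
  simpa using h p (by simpa using hp)

/-- If every correct replica reaches round `k`, then every correct replica `q` eventually has the
blocks of round `k` of all correct replicas. -/
theorem eventually_forall_exists_mem_dag (he : IsExecution e) {q : Replica f} (hq : Correct e q)
    {k : ℕ} (hk : 1 ≤ k) (h : ∀ p, Correct e p → ∃ t, k ≤ ((run e t).loc p).round) :
    ∀ᶠ t in Filter.atTop, ∀ p, Correct e p →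
      ∃ b ∈ ((run e t).loc q).dag, b.author = p ∧ b.round = k := by
  rw [Filter.eventually_all]
  intro p
  by_cases hp : Correct e p
  · obtain ⟨t, ht⟩ := h p hp
    obtain ⟨b, hb, hbk⟩ := exists_mem_proposed hk ht
    filter_upwards [eventually_mem_dag he hp hq hb] with t' ht' _
    exact ⟨b, ht', author_of_mem_proposed hb, hbk⟩
  · exact Filter.Eventually.of_forall fun t h => absurd h hp

/-- Every correct replica reaches every round: once all correct replicas have proposed in round
`k`, they receive each other's blocks of that round, of which there are at least `f + 1`. -/
theorem exists_le_round (he : IsExecution e) (k : ℕ) :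
    ∀ p, Correct e p → ∃ t, k ≤ ((run e t).loc p).round := by
  induction k with
  | zero => exact fun p _ => ⟨0, Nat.zero_le _⟩
  | succ k ih =>
    intro p hp
    have key : ∃ T, k ≤ ((run e T).loc p).round ∧ ∀ t ≥ T, ((run e t).loc p).round = k →
        Ready p ((run e t).loc p) := by
      rcases Nat.eq_zero_or_pos k with rfl | hk
      · exact ⟨0, Nat.zero_le _, fun t _ h => Or.inl h⟩
      have hall := eventually_forall_exists_mem_dag he hp hk ih
      obtain ⟨t₀, ht₀⟩ := ih p hp
      obtain ⟨T, hT⟩ := (hall.and (Filter.eventually_ge_atTop t₀)).exists_forall_of_atTop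
      refine ⟨T, ht₀.trans (round_mono (hT T le_rfl).2 p), fun t ht hrd => Or.inr ⟨?_, ?_⟩⟩
      · rw [hrd]
        refine le_trans (succ_le_card_of_forall_correct he (s := (blocksAt ((run e t).loc p).dag k).toFinset)
          fun q hq => ?_) (List.toFinset_card_le _)
        obtain ⟨b, hb, hbq, hbk⟩ := (hT t ht).1 q hq
        exact ⟨b, by simp [blocksAt, hb, hbk], hbq⟩
      · rw [hrd]
        exact (hT t ht).1 p hp
    obtain ⟨T, hkT, hready⟩ := key
    rcases hkT.lt_or_eq with h | h
    · exact ⟨T, h⟩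
    obtain ⟨t, ht, txs, extra, hev⟩ := he.proposes T p hp (hready T le_rfl h.symm)
    rcases (hkT.trans (round_mono ht p)).lt_or_eq with h | h
    · exact ⟨t, h⟩
    refine ⟨t + 1, ?_⟩
    rw [run, hev]
    simp [step, hp t, hready t ht h.symm, ← h]

end Transitions

section Decisions

variable {f : ℕ} {Tx : Type*}

/-! ### Committed slots of two successive rounds -/

theorem slots_succ (ℓ h : ℕ) :
    slots ℓ (h + 1) = slots ℓ h ++ (List.range ℓ).map fun l => (h + 1, l) := by
  simp [slots, List.range_succ]

theorem le_of_mem_slots {ℓ h : ℕ} {s : ℕ × ℕ} (hs : s ∈ slots ℓ h) : s.1 ≤ h := by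
  simp only [slots, List.mem_flatMap, List.mem_range, List.mem_map] at hs
  obtain ⟨i, hi, l, -, rfl⟩ := hs
  exact hi

/-- The list of slots, split at the first slots of the rounds `r + 1` and `r + 2`. -/
theorem slots_eq_append {ℓ r h : ℕ} (hℓ : 1 ≤ ℓ) (h' : r + 2 ≤ h) :
    ∃ N L, slots ℓ h = slots ℓ r ++ (r + 1, 0) :: (N ++ (r + 2, 0) :: L) ∧
      ∀ s ∈ N, s.1 = r + 1 := by
  obtain ⟨m, rfl⟩ := Nat.exists_eq_add_of_le' hℓ
  induction h, h' using Nat.le_induction with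
  | base =>
    refine ⟨((List.range m).map Nat.succ).map fun l => (r + 1, l),
      ((List.range m).map Nat.succ).map fun l => (r + 2, l), ?_, by simp⟩
    rw [slots_succ, slots_succ, List.range_succ_eq_map]
    simp
  | succ h _ ih =>
    obtain ⟨N, L, hs, hN⟩ := ih
    exact ⟨N, L ++ (List.range (m + 1)).map fun l => (h + 1, l), by simp [slots_succ _ h, hs], hN⟩

/-- The states of the slots in `L`, given the states `S` of the slots after them. -/
noncomputable def decideFrom (D : List (Block f Tx)) (L : List (ℕ × ℕ)) (S : List (Decision f Tx)) :
    List (Decision f Tx) :=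
  L.foldr (fun s S => ⟨s.1, s.2, decideSlot D s.1 s.2 S⟩ :: S) S

theorem exists_decideFrom_append (D : List (Block f Tx)) (L : List (ℕ × ℕ))
    (S : List (Decision f Tx)) :
    ∃ N, decideFrom D L S = N ++ S ∧ ∀ d ∈ N, ∃ s ∈ L, d.round = s.1 := by
  induction L with
  | nil => exact ⟨[], rfl, by simp⟩
  | cons s L ih =>
    obtain ⟨N, hN, h⟩ := ih
    refine ⟨⟨s.1, s.2, decideSlot D s.1 s.2 (decideFrom D L S)⟩ :: N, ?_, ?_⟩
    · rw [List.cons_append, ← hN]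
      rfl
    · intro d hd
      rcases List.mem_cons.1 hd with rfl | hd
      · exact ⟨s, by simp, rfl⟩
      · obtain ⟨s', hs', h'⟩ := h d hd
        exact ⟨s', by simp [hs'], h'⟩

theorem decideSlot_eq_commit {D : List (Block f Tx)} {r l : ℕ} {b : Block f Tx}
    (hb : leaderBlock D r l = some b) (hs : Supported D b) (S : List (Decision f Tx)) :
    decideSlot D r l S = .commit b := by
  simp [decideSlot, tryDirectDecide, hb, hs]

/-- A slot whose anchor is committed is decided. -/
theorem decideSlot_ne_undecided (D : List (Block f Tx)) {r l : ℕ} {S : List (Decision f Tx)}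
    {r' l' : ℕ} {b' : Block f Tx}
    (h : S.find? (fun s => r + 1 < s.round ∧ s.status ≠ .skip) = some ⟨r', l', .commit b'⟩) :
    decideSlot D r l S ≠ .undecided := by
  have hind : tryIndirectDecide D r l S ≠ .undecided := by
    rw [tryIndirectDecide, h]
    cases leaderBlock D r l with
    | none => simp
    | some b =>
      simp only
      split_ifs <;> simp
  unfold decideSlot
  split
  · exact hind
  · assumption

/-- If the first slots of the rounds `r` and `r + 1` are committed, then all slots of earlier
rounds are decided. The anchor of a slot of round `r - 1` is the first slot of round `r + 1`,
whatever the states of the other slots of round `r`; the anchor of a slot of an earlier round is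
not later than the first slot of round `r`, and all slots up to that one are decided. -/
theorem exists_decideFrom_decided (D : List (Block f Tx)) {r : ℕ} {b₀ b₁ : Block f Tx}
    {N T : List (Decision f Tx)} (hN : ∀ d ∈ N, d.round = r) (L : List (ℕ × ℕ))
    (hL : ∀ s ∈ L, s.1 < r) :
    ∃ A, decideFrom D L (⟨r, 0, .commit b₀⟩ :: (N ++ ⟨r + 1, 0, .commit b₁⟩ :: T)) =
        A ++ ⟨r, 0, .commit b₀⟩ :: (N ++ ⟨r + 1, 0, .commit b₁⟩ :: T) ∧
      ∀ d ∈ A, d.round < r ∧ d.status ≠ .undecided := by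
  induction L with
  | nil => exact ⟨[], rfl, by simp⟩
  | cons s L ih =>
    obtain ⟨A, hA, h⟩ := ih fun s hs => hL s (by simp [hs])
    have hs := hL s (by simp)
    set S := decideFrom D L (⟨r, 0, .commit b₀⟩ :: (N ++ ⟨r + 1, 0, .commit b₁⟩ :: T))
    refine ⟨⟨s.1, s.2, decideSlot D s.1 s.2 S⟩ :: A, ?_, ?_⟩
    · rw [List.cons_append, ← hA]
      rfl
    · intro d hd
      rcases List.mem_cons.1 hd with rfl | hd
      swap
      · exact h d hd
      refine ⟨hs, ?_⟩
      suffices ∃ r' l' b', S.find? (fun d => s.1 + 1 < d.round ∧ d.status ≠ .skip) =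
          some ⟨r', l', .commit b'⟩ by
        obtain ⟨r', l', b', h'⟩ := this
        exact decideSlot_ne_undecided D h'
      rw [hA, List.find?_append]
      cases hf : A.find? (fun d => s.1 + 1 < d.round ∧ d.status ≠ .skip) with
      | some d =>
        have h1 := (h d (List.mem_of_find?_eq_some hf)).2
        have h2 := List.find?_some hf
        obtain ⟨r', l', st⟩ := d
        cases st with
        | commit b' => exact ⟨r', l', b', rfl⟩
        | skip => simp at h2
        | undecided => exact absurd rfl h1
      | none =>
        rcases Nat.lt_or_ge (s.1 + 1) r with hr | hr
        · exact ⟨r, 0, b₀, by simp [hr]⟩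
        · refine ⟨r + 1, 0, b₁, ?_⟩
          have hN' : N.find? (fun d => s.1 + 1 < d.round ∧ d.status ≠ .skip) = none := by
            rw [List.find?_eq_none]
            intro d hd
            have := hN d hd
            simp only [ne_eq, decide_eq_true_eq, not_and]
            omega
          rw [List.find?_cons_of_neg (by simp [hr.not_gt]), List.find?_append, hN',
            List.find?_cons_of_pos (by simp; omega)]
          rfl

/-- If the first slots of two successive rounds are directly committed, then the block of the
former is among the committed skeleton blocks that precede the first undecided slot. -/
theorem mem_committedLeaders {D : List (Block f Tx)} {ℓ r : ℕ} (hℓ : 1 ≤ ℓ)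
    (hD : r + 2 ≤ highestRound D) {b₀ b₁ : Block f Tx}
    (h₀ : leaderBlock D (r + 1) 0 = some b₀) (hs₀ : Supported D b₀)
    (h₁ : leaderBlock D (r + 2) 0 = some b₁) (hs₁ : Supported D b₁) :
    b₀ ∈ committedLeaders ℓ D := by
  obtain ⟨N, L, hsl, hN⟩ := slots_eq_append hℓ hD
  obtain ⟨N', hN', hr⟩ := exists_decideFrom_append D N
    (⟨r + 2, 0, .commit b₁⟩ :: decideFrom D L [])
  obtain ⟨A, hA, hd⟩ := exists_decideFrom_decided D (r := r + 1) (b₀ := b₀) (b₁ := b₁)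
    (N := N') (T := decideFrom D L [])
    (fun d hd => by
      obtain ⟨s, hs, h⟩ := hr d hd
      rw [h, hN s hs])
    (slots ℓ r) (fun s hs => Nat.lt_succ_of_le (le_of_mem_slots hs))
  have hdec : tryDecide ℓ D = A ++ ⟨r + 1, 0, .commit b₀⟩ ::
      (N' ++ ⟨r + 2, 0, .commit b₁⟩ :: decideFrom D L []) := by
    rw [← hA, ← hN']
    simp only [tryDecide, hsl, List.foldr_append, List.foldr_cons, decideFrom,
      decideSlot_eq_commit h₀ hs₀, decideSlot_eq_commit h₁ hs₁]
  rw [committedLeaders, hdec, List.takeWhile_append_of_pos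
    (fun d h => by simpa using (hd d h).2), List.takeWhile_cons_of_pos (by simp)]
  simp

/-! ### The commit sequence contains the causal histories of the committed skeleton blocks -/

theorem subset_linearizeSubDags (order : Finset (Block f Tx) → List (Block f Tx))
    (D L O : List (Block f Tx)) : O ⊆ linearizeSubDags order D O L := by
  induction L generalizing O with
  | nil => exact List.Subset.refl _
  | cons b L ih => exact List.Subset.trans (List.subset_append_left _ _) (ih _)

theorem mem_linearizeSubDags {order : Finset (Block f Tx) → List (Block f Tx)}
    (horder : ∀ s, ∀ b ∈ s, b ∈ order s) {D L : List (Block f Tx)} (O : List (Block f Tx))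
    {b b' : Block f Tx} (hb : b ∈ L) (hb' : b' ∈ D) (hl : IsLink D b b') :
    b' ∈ linearizeSubDags order D O L := by
  induction L generalizing O with
  | nil => simp at hb
  | cons c L ih =>
    rcases List.mem_cons.1 hb with rfl | hb
    · refine subset_linearizeSubDags order D L _ ?_
      by_cases hO : b' ∈ O
      · exact List.mem_append_left _ hO
      · exact List.mem_append_right _ (horder _ _ (by simp [hb', hl, hO]))
    · exact ih _ hb

theorem le_highestRound {D : List (Block f Tx)} {b : Block f Tx} (hb : b ∈ D) :
    b.round ≤ highestRound D := by
  induction D with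
  | nil => simp at hb
  | cons c D ih =>
    rcases List.mem_cons.1 hb with rfl | hb
    · exact le_max_left _ _
    · exact (ih hb).trans (le_max_right _ _)

end Decisions

section Validity

variable {f : ℕ} {Tx : Type*} {e : ℕ → Event f Tx}

/-! ### Rounds with favourable orders -/

/-- If a correct replica `c` comes first in the order for `(x, k)`, then the block of `x` of round
`k + 1` references the block of `c` of round `k`. -/
theorem first_ref_mem_refs {ρ : Replica f × ℕ → Equiv.Perm (Replica f)}
    (hρ : FollowsOrders ρ e) {c x : Replica f} (hc : Correct e c) (hx : Correct e x) {k : ℕ}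
    (hk : 1 ≤ k) (hfirst : ρ (x, k) c = 0) {t : ℕ} {b : Block f Tx}
    (hb : b ∈ ((run e t).loc x).proposed) (hbk : b.round = k + 1) : (c, k) ∈ b.refs := by
  obtain ⟨t', -, txs, extra, hr, rfl, -⟩ := exists_newBlock_of_mem_proposed hb
  obtain rfl : ((run e t').loc x).round = k := Nat.succ_injective hbk
  rcases hr with hr | ⟨hlen, -⟩
  · omega
  have hmem : ∃ b ∈ firstBlocks ((run e t').loc x).dag ((run e t').loc x).round,
      b.author = c := by
    by_contra! hne
    have hpos : 0 < (firstBlocks ((run e t').loc x).dag ((run e t').loc x).round).length := by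
      simp only [firstBlocks, List.length_take]
      omega
    have := hρ x _ t' hx hlen c hc hne _ (List.getElem_mem hpos)
    rw [hfirst] at this
    exact absurd this (Fin.not_lt_zero _)
  obtain ⟨b, hb, hbc⟩ := hmem
  have hround : b.round = ((run e t').loc x).round := by
    have := List.mem_of_mem_take hb
    simp only [blocksAt, List.mem_filter, decide_eq_true_eq] at this
    exact this.2
  simp only [newBlock, Finset.mem_union, List.mem_toFinset, List.mem_map]
  exact Or.inl (Or.inl ⟨b, hb, by simp [Block.ref, hbc, hround]⟩)

/-- If a correct replica `c` comes first in all orders for round `k`, then its block of that round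
is supported in every local DAG that has the blocks of round `k + 1` of all correct replicas. -/
theorem supported_of_first {ρ : Replica f × ℕ → Equiv.Perm (Replica f)} (he : IsExecution e)
    (hρ : FollowsOrders ρ e) {c q : Replica f} (hc : Correct e c) {k t : ℕ} (hk : 1 ≤ k)
    (hfirst : ∀ x, ρ (x, k) c = 0)
    (hD : ∀ x, Correct e x → ∃ b ∈ ((run e t).loc q).dag, b.author = x ∧ b.round = k + 1)
    {b : Block f Tx} (hbc : b.author = c) (hbk : b.round = k) :
    Supported ((run e t).loc q).dag b := by
  refine succ_le_card_of_forall_correct he fun x hx => ?_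
  obtain ⟨b', hb', rfl, hr⟩ := hD x hx
  refine ⟨b', ?_, rfl⟩
  have href := first_ref_mem_refs hρ hc hx hk (hfirst _) ((wellFormed_run e t).dag q b' hb').1 hr
  simp only [Finset.mem_filter, List.mem_toFinset, hbk]
  exact ⟨hb', hr, .single ⟨hb', by simpa [Block.ref, hbc, hbk] using href⟩⟩

theorem leaderBlock_eq_some {q : Replica f} {t k l : ℕ} {b : Block f Tx}
    (hb : b ∈ ((run e t).loc q).dag) (hbk : b.round = k) (hbl : b.author = leader f k l) :
    leaderBlock ((run e t).loc q).dag k l = some b := by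
  cases h : leaderBlock ((run e t).loc q).dag k l with
  | none =>
    have := List.find?_eq_none.1 h b hb
    simp [hbk, hbl] at this
  | some b' =>
    have h1 := List.mem_of_find?_eq_some h
    have h2 := List.find?_some h
    simp only [decide_eq_true_eq] at h2
    rw [eq_of_ref_eq h1 hb (by simp [Block.ref, h2, hbk, hbl])]

/-- The blocks of one author in a local DAG form a chain. -/
theorem isLink_of_author_eq {q : Replica f} {t : ℕ} {B : Block f Tx}
    (hB : B ∈ ((run e t).loc q).dag) (k : ℕ) {b : Block f Tx}
    (hb : b ∈ ((run e t).loc q).dag) (hauthor : b.author = B.author)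
    (hround : b.round = B.round + k) : IsLink ((run e t).loc q).dag b B := by
  have hwf := wellFormed_run e t
  induction k generalizing b with
  | zero => rw [eq_of_ref_eq hb hB (by simp [Block.ref, hauthor, hround])]; exact .refl
  | succ k ih =>
    have hB1 := one_le_round_of_mem_proposed (hwf.dag q B hB).1
    have href := own_ref_mem_refs (hwf.dag q b hb).1 (k := B.round + k) (by omega) hround
    obtain ⟨b', hb', hbr⟩ := (hwf.dag q b hb).2 _ href
    have hbr' := hbr
    simp only [Block.ref, Prod.mk.injEq] at hbr'
    exact .head ⟨hb, hbr ▸ href⟩ (ih hb' (hbr'.1.trans hauthor) hbr'.2)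

/-- If the author `p` of `B`, the owner `c` of the first slot of round `s + 1` and the owner `c'`
of the first slot of round `s + 2` are correct and come first in all orders for the rounds `s`,
`s + 1` and `s + 2`, respectively, then `B` is eventually committed. -/
theorem eventually_mem_commitSequence {ρ : Replica f × ℕ → Equiv.Perm (Replica f)}
    (he : IsExecution e) (hρ : FollowsOrders ρ e) {ℓ : ℕ} (hℓ : 1 ≤ ℓ)
    {order : Finset (Block f Tx) → List (Block f Tx)} (horder : ∀ s, ∀ b ∈ s, b ∈ order s)
    {p q c c' : Replica f} (hp : Correct e p) (hq : Correct e q) (hc : Correct e c)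
    (hc' : Correct e c') {t : ℕ} {B : Block f Tx} (hB : B ∈ ((run e t).loc p).proposed) {s : ℕ}
    (hs : B.round ≤ s) (hcs : leader f (s + 1) 0 = c) (hcs' : leader f (s + 2) 0 = c')
    (h₀ : ∀ x, ρ (x, s) p = 0) (h₁ : ∀ x, ρ (x, s + 1) c = 0) (h₂ : ∀ x, ρ (x, s + 2) c' = 0) :
    ∀ᶠ t' in Filter.atTop, B ∈ commitSequence ℓ order ((run e t').loc q).dag := by
  have hs1 : 1 ≤ s := (one_le_round_of_mem_proposed hB).trans hs
  have hev (k : ℕ) (hk : 1 ≤ k) := eventually_forall_exists_mem_dag he hq hk (exists_le_round he k)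
  filter_upwards [eventually_mem_dag he hp hq hB, hev (s + 1) (by omega), hev (s + 2) (by omega),
    hev (s + 3) (by omega)] with T hBD hD₁ hD₂ hD₃
  have hwf := wellFormed_run e T
  obtain ⟨b₀, hb₀, hbc₀, hbr₀⟩ := hD₁ c hc
  obtain ⟨b₁, hb₁, hbc₁, hbr₁⟩ := hD₂ c' hc'
  refine mem_linearizeSubDags horder [] (mem_committedLeaders hℓ (r := s) (b₁ := b₁) ?_
    (leaderBlock_eq_some hb₀ hbr₀ (hbc₀.trans hcs.symm))
    (supported_of_first he hρ hc (by omega) h₁ hD₂ hbc₀ hbr₀)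
    (leaderBlock_eq_some hb₁ hbr₁ (hbc₁.trans hcs'.symm))
    (supported_of_first he hρ hc' (by omega) h₂ hD₃ hbc₁ hbr₁)) hBD ?_
  · exact hbr₁ ▸ le_highestRound hb₁
  · have hb₀' := hwf.dag q b₀ hb₀
    have href := first_ref_mem_refs hρ hp hc hs1 (h₀ c) (hbc₀ ▸ hb₀'.1) hbr₀
    obtain ⟨b, hb, hbr⟩ := hb₀'.2 _ href
    have hbr' := hbr
    simp only [Block.ref, Prod.mk.injEq] at hbr'
    exact .head ⟨hb₀, hbr ▸ href⟩ (isLink_of_author_eq hBD (s - B.round) hb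
      (hbr'.1.trans (author_of_mem_proposed hB).symm) (by omega))

/-- Two replicas that are neighbours in the round-robin order are correct, since more than half of
the replicas are. -/
theorem exists_correct_correct_succ (he : IsExecution e) :
    ∃ c : Replica f, Correct e c ∧ Correct e (c + 1) := by
  by_contra! h
  have hcard := card_correct he
  set S := Finset.univ.filter (Correct e) with hS
  have hdisj : Disjoint S (S.image (· + 1)) := by
    rw [Finset.disjoint_left]
    intro x hx hx'
    obtain ⟨c, hc, rfl⟩ := Finset.mem_image.1 hx'
    exact h c (by simpa [hS] using hc) (by simpa [hS] using hx)
  have h1 := Finset.card_le_univ (S ∪ S.image (· + 1))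
  rw [Finset.card_union_of_disjoint hdisj, Finset.card_image_of_injective _ (add_left_injective 1),
    Fintype.card_fin] at h1
  omega

theorem leader_eq (c : Replica f) (j m : ℕ) :
    leader f (c + j + (2 * f + 1) * m) 0 = c + Fin.ofNat (2 * f + 1) j := by
  ext
  simp [leader, Fin.val_add]

end Validity

/-! ### Favourable orders recur almost surely -/

section Recurrence

open MeasureTheory ProbabilityTheory

theorem measure_iInter_prod {Ω ι κ : Type*} [Fintype κ] {_ : MeasurableSpace Ω} {μ : Measure Ω}
    {A : ι × κ → Set Ω} (hm : ∀ i, MeasurableSet (A i)) (h : iIndepSet A μ) (i : ι) :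
    μ (⋂ k, A (i, k)) = ∏ k, μ (A (i, k)) := by
  have := (iIndepSet_iff_meas_biInter hm).1 h ({i} ×ˢ Finset.univ)
  rw [Finset.prod_product, Finset.prod_singleton] at this
  rw [← this]
  congr 1
  ext ω
  simp

theorem iIndepSet_iInter_prod {Ω ι κ : Type*} [Fintype κ] {_ : MeasurableSpace Ω} {μ : Measure Ω}
    {A : ι × κ → Set Ω} (hm : ∀ i, MeasurableSet (A i)) (h : iIndepSet A μ) :
    iIndepSet (fun i => ⋂ k, A (i, k)) μ := by
  rw [iIndepSet_iff_meas_biInter fun i => MeasurableSet.iInter fun k => hm _]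
  intro s
  have := (iIndepSet_iff_meas_biInter hm).1 h (s ×ˢ Finset.univ)
  rw [Finset.prod_product] at this
  simp_rw [measure_iInter_prod hm h, ← this]
  congr 1
  ext ω
  simp only [Set.mem_iInter, Finset.mem_product, Finset.mem_univ, and_true, Prod.forall]
  exact ⟨fun h a b ha => h a ha b, fun h a ha b => h a b ha⟩

/-- Almost surely, every pattern of orders for three successive rounds, the same for all replicas,
occurs infinitely often when the first of these rounds runs through an arithmetic progression. The
difference is at least `3`, so that the patterns concern disjoint sets of rounds. -/
theorem IsRandomOrders.ae_frequently {f : ℕ} {Ω : Type*} [MeasurableSpace Ω] {μ : Measure Ω}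
    [IsProbabilityMeasure μ] {π : Replica f × ℕ → Ω → Equiv.Perm (Replica f)}
    (hπ : IsRandomOrders μ π) (a : ℕ) {d : ℕ} (hd : 3 ≤ d)
    (σ : Fin 3 → Equiv.Perm (Replica f)) :
    ∀ᵐ ω ∂μ, ∃ᶠ k in Filter.atTop, ∀ x (j : Fin 3), π (x, a + d * k + j) ω = σ j := by
  let g : ℕ × (Replica f × Fin 3) → Replica f × ℕ := fun i => (i.2.1, a + d * i.1 + i.2.2)
  have hg : Function.Injective g := by
    rintro ⟨k, x, j⟩ ⟨k', x', j'⟩ h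
    simp only [g, Prod.mk.injEq] at h
    obtain ⟨rfl, h⟩ := h
    have hj := j.2
    have hj' := j'.2
    -- The offsets `j` and `j'` are less than `3 ≤ d`.
    have hk : k = k' := by
      rcases lt_trichotomy k k' with hlt | heq | hlt
      · have := Nat.mul_le_mul_left d (Nat.succ_le_of_lt hlt)
        rw [Nat.mul_succ] at this
        omega
      · exact heq
      · have := Nat.mul_le_mul_left d (Nat.succ_le_of_lt hlt)
        rw [Nat.mul_succ] at this
        omega
    subst hk
    obtain rfl : j = j' := Fin.ext (by omega)
    rfl
  let A : ℕ × (Replica f × Fin 3) → Set Ω := fun i => {ω | π (g i) ω = σ i.2.2}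
  have hm (i) : MeasurableSet (A i) := hπ.measurable _ _
  have hA : iIndepSet A μ := by
    rw [iIndepSet_iff_meas_biInter hm]
    intro s
    exact (hπ.indep.precomp hg).measure_inter_preimage_eq_mul s
      (sets := fun i => {σ i.2.2}) fun _ _ => trivial
  have hlim := measure_limsup_eq_one (fun k => MeasurableSet.iInter fun y => hm (k, y))
    (iIndepSet_iInter_prod hm hA) (by
      have hμ (k : ℕ) : μ (⋂ y, A (k, y)) =
          ∏ _y : Replica f × Fin 3, ((Nat.factorial (2 * f + 1) : ℕ) : ENNReal)⁻¹ := by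
        rw [measure_iInter_prod hm hA]
        exact Finset.prod_congr rfl fun y _ => hπ.uniform _ _
      simp_rw [hμ]
      refine ENNReal.tsum_const_eq_top_of_ne_zero ?_
      simp [ENNReal.natCast_ne_top])
  have hae := (mem_ae_iff_prob_eq_one (MeasurableSet.measurableSet_limsup fun k =>
    MeasurableSet.iInter fun y => hm (k, y))).2 hlim
  filter_upwards [hae] with ω hω
  rw [Filter.mem_limsup_iff_frequently_mem] at hω
  refine hω.mono fun k hk x j => ?_
  exact Set.mem_iInter.1 hk (x, j)

end Recurrence

end NemoNemo

theorem mainTheorem5 {f : ℕ} {Tx : Type*}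
    (leadersPerRound : ℕ) (hL : 1 ≤ leadersPerRound) (hL' : leadersPerRound ≤ 2 * f + 1)
    (order : Finset (NemoNemo.Block f Tx) → List (NemoNemo.Block f Tx))
    (horder : ∀ s, (order s).Nodup ∧ ∀ b, b ∈ order s ↔ b ∈ s)
    {Ω : Type*} [MeasurableSpace Ω] (μ : MeasureTheory.Measure Ω)
    [MeasureTheory.IsProbabilityMeasure μ]
    (π : NemoNemo.Replica f × ℕ → Ω → Equiv.Perm (NemoNemo.Replica f))
    (e : Ω → ℕ → NemoNemo.Event f Tx)
    (hmodel : NemoNemo.RandomAsynchronous μ π e) :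
    ∀ᵐ ω ∂μ, ∀ p, NemoNemo.Correct (e ω) p →
      ∀ t, ∀ B ∈ ((NemoNemo.run (e ω) t).loc p).proposed,
        ∀ q, NemoNemo.Correct (e ω) q →
          ∀ᶠ t' in Filter.atTop,
            B ∈ NemoNemo.commitSequence leadersPerRound order
              ((NemoNemo.run (e ω) t').loc q).dag := by
  -- `Equiv.swap p 0` is an order in which `p` comes first.
  have hrec : ∀ᵐ ω ∂μ, ∀ c p : NemoNemo.Replica f, ∃ᶠ k in Filter.atTop, ∀ x (j : Fin 3),
      π (x, c + 2 * f + (2 * f + 1) * 3 * k + j) ω =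
        ![Equiv.swap p 0, Equiv.swap c 0, Equiv.swap (c + 1) 0] j := by
    rw [MeasureTheory.ae_all_iff]
    intro c
    rw [MeasureTheory.ae_all_iff]
    exact fun p => hmodel.orders.ae_frequently _ (by omega) _
  filter_upwards [hrec, hmodel.execution, hmodel.follows] with ω hω he hρ p hp t B hB q hq
  obtain ⟨c, hc, hc'⟩ := NemoNemo.exists_correct_correct_succ he
  obtain ⟨k, hk, hBk⟩ :=
    ((hω c p).and_eventually (Filter.eventually_ge_atTop B.round)).exists
  have hle : k ≤ (2 * f + 1) * 3 * k := Nat.le_mul_of_pos_left k (by omega)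
  refine NemoNemo.eventually_mem_commitSequence he hρ hL (fun s b => ((horder s).2 b).2)
    hp hq hc hc' hB (s := c + 2 * f + (2 * f + 1) * 3 * k) (by omega) ?_ ?_ ?_ ?_ ?_
  -- The rounds `s + 1` and `s + 2` are congruent to `c` and `c + 1` modulo `2 * f + 1`.
  · have := NemoNemo.leader_eq c 0 (3 * k + 1)
    rw [show (c : ℕ) + 2 * f + (2 * f + 1) * 3 * k + 1 =
      c + 0 + (2 * f + 1) * (3 * k + 1) by ring, this]
    simp
  · have := NemoNemo.leader_eq c 1 (3 * k + 1)
    rw [show (c : ℕ) + 2 * f + (2 * f + 1) * 3 * k + 2 =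
      c + 1 + (2 * f + 1) * (3 * k + 1) by ring, this]
    rfl
  · intro x
    have h : π (x, _) ω = _ := hk x 0
    exact (congrArg (· p) h).trans (Equiv.swap_apply_left p 0)
  · intro x
    have h : π (x, _) ω = _ := hk x 1
    exact (congrArg (· c) h).trans (Equiv.swap_apply_left c 0)
  · intro x
    have h : π (x, _) ω = _ := hk x 2
    exact (congrArg (· (c + 1)) h).trans (Equiv.swap_apply_left (c + 1) 0)
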